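/- Let $M$ be a smooth ($C^\infty$, finite-dimensional, Hausdorff, second countable, boundaryless) manifold and let $A\to M$ be a smooth real vector bundle of finite rank. A \emph{Lie algebroid structure} $\mu$ on $A$ consists of a smooth vector bundle map $\rho:A\to TM$ (the anchor) and an $\mathbb R$-bilinear Lie bracket $[\cdot,\cdot]_\mu$ on $\Gamma(A)$ with $[X,fY]_\mu=f[X,Y]_\mu+(\rho(X)f)\,Y$ for $f\in C^\infty(M)$. Let $d_\mu$ be the differential on forms (sections of $\wedge^\bullet A^*$); on a $2$-form $\omega$, $$(d_\mu\omega)(X,Y,Z)=\rho(X)\omega(Y,Z)-\rho(Y)\omega(X,Z)+\rho(Z)\omega(X,Y)-\omega([X,Y]_\mu,Z)+\omega([X,Z]_\mu,Y)-\omega([Y,Z]_\mu,X).$$ Put $\langle L_X\alpha,Y\rangle=\rho(X)\langle\alpha,Y\rangle-\langle\alpha,[X,Y]_\mu\rangle$ for $\alpha\in\Gamma(A^*)$. A bivector $\pi\in\Gamma(\wedge^2A)$ defines $\pi^\sharp:A^*\to A$ by $\langle\beta,\pi^\sharp\alpha\rangle=\pi(\alpha,\beta)$, and a $2$-form $\omega$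 defines $\omega^\flat:A\to A^*$ by $\omega^\flat X=-i_X\omega$. The Koszul bracket of $1$-forms is $$[\alpha,\beta]_{\pi}=L_{\pi^\sharp\alpha}\beta-L_{\pi^\sharp\beta}\alpha-d_\mu(\pi(\alpha,\beta)).$$ The Schouten bracket $[\pi,\pi]_\mu\in\Gamma(\wedge^3A)$ is given by $$[\pi,\pi]_\mu(\alpha,\beta,\gamma)=\sum_{\mathrm{cyclic}}\Big(\rho(\pi^\sharp\alpha)\big(\pi(\beta,\gamma)\big)-\pi([\alpha,\beta]_\pi,\gamma)\Big),$$ and $\pi$ is \emph{Poisson} if $[\pi,\pi]_\mu=0$. For a $(1,1)$-tensor $N$ (a smooth bundle endomorphism of $A$, with transpose $N^*$), the Nijenhuis torsion is $$(\mathcal T_\mu N)(X,Y)=[NX,NY]_\mu-N\big([NX,Y]_\mu+[X,NY]_\mu\big)+N^2[X,Y]_\mu,$$ and $N$ is a \emph{Nijenhuis tensor} if $\mathcal T_\mu N=0$. The deformed structure $\mu_N$ has anchor $\rho\circ N$ and bracket $[X,Y]_{\mu_N}=[NX,Y]_\mu+[X,NY]_\mu-N[X,Y]_\mu$. The pair $(\pi,N)$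 is \emph{compatible} if $N\circ\pi^\sharp=\pi^\sharp\circ N^*$ and, for all $1$-forms $\alpha,\beta$, $$[\alpha,\beta]_{\pi}^{\mu_N}=[N^*\alpha,\beta]_\pi+[\alpha,N^*\beta]_\pi-N^*[\alpha,\beta]_\pi,$$ where the left-hand side is the Koszul bracket of $\pi$ formed with $\mu_N$ in place of $\mu$. The pair $(\pi,N)$ is a \emph{$PN$-structure} if $\pi$ is Poisson, $N$ is a Nijenhuis tensor, and $\pi$ and $N$ are compatible. The pair $(\pi,\omega)$ is a \emph{$P\Omega$-structure} if $\pi$ is a Poisson bivector, $d_\mu\omega=0$ and $d_\mu(\omega_N)=0$, where $N=\pi^\sharp\circ\omega^\flat$ and $\omega_N$ is the $2$-form with $\omega_N^\flat=\omega^\flat\circ N$ (one has $\omega^\flat\circ N=N^*\circ\omega^\flat$). \textbf{Theorem.} Let $(A,\mu)$ be a Lie algebroid and $\pi$ a bivector on $A$. (i) If $\omega$ is a $2$-form such that $(\pi,\omega)$ is a $P\Omega$-structure, then $(\pi,N)$ with $N=\pi^\sharp\circ\omega^\flat$ is a $PN$-structure. (ii) Conversely, if $\pi$ is non-degenerate ($\pi^\sharp$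 is an isomorphism on every fibre) and $(\pi,N)$ is a $PN$-structure, then $\omega^\flat=(\pi^\sharp)^{-1}\circ N$ defines a smooth $2$-form $\omega$, and $(\pi,\omega)$ is a $P\Omega$-structure. -/

import Mathlib

open Bundle
open scoped Manifold ContDiff

noncomputable section

namespace LieAlgd

/-! ### Smooth bundle maps acting on smooth sections -/

section Composition

variable {E : Type*} [NormedAddCommGroup E] [NormedSpace ℝ E]
  {H : Type*} [TopologicalSpace H] {I : ModelWithCorners ℝ E H}
  {M : Type*} [TopologicalSpace M] [ChartedSpace H M]
  {F₁ F₂ F₃ : Type*} [NormedAddCommGroup F₁] [NormedSpace ℝ F₁]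
  [NormedAddCommGroup F₂] [NormedSpace ℝ F₂] [NormedAddCommGroup F₃] [NormedSpace ℝ F₃]
  {V₁ : M → Type*} [TopologicalSpace (TotalSpace F₁ V₁)]
  [∀ x, AddCommGroup (V₁ x)] [∀ x, Module ℝ (V₁ x)] [∀ x, TopologicalSpace (V₁ x)]
  [FiberBundle F₁ V₁] [VectorBundle ℝ F₁ V₁]
  {V₂ : M → Type*} [TopologicalSpace (TotalSpace F₂ V₂)]
  [∀ x, AddCommGroup (V₂ x)] [∀ x, Module ℝ (V₂ x)] [∀ x, TopologicalSpace (V₂ x)]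
  [∀ x, IsTopologicalAddGroup (V₂ x)] [∀ x, ContinuousSMul ℝ (V₂ x)]
  [FiberBundle F₂ V₂] [VectorBundle ℝ F₂ V₂]
  {V₃ : M → Type*} [TopologicalSpace (TotalSpace F₃ V₃)]
  [∀ x, AddCommGroup (V₃ x)] [∀ x, Module ℝ (V₃ x)] [∀ x, TopologicalSpace (V₃ x)]
  [∀ x, IsTopologicalAddGroup (V₃ x)] [∀ x, ContinuousSMul ℝ (V₃ x)]
  [FiberBundle F₃ V₃] [VectorBundle ℝ F₃ V₃]

/-- The section `x ↦ T x (X x)`. -/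
def applySec (T : Cₛ^∞⟮I; F₁ →L[ℝ] F₂, fun x => V₁ x →L[ℝ] V₂ x⟯) (X : Cₛ^∞⟮I; F₁, V₁⟯) :
    Cₛ^∞⟮I; F₂, V₂⟯ :=
  ⟨fun x => T x (X x), T.contMDiff.clm_bundle_apply X.contMDiff⟩

/-- The section `x ↦ S x ∘ T x`. -/
def compSec (S : Cₛ^∞⟮I; F₂ →L[ℝ] F₃, fun x => V₂ x →L[ℝ] V₃ x⟯)
    (T : Cₛ^∞⟮I; F₁ →L[ℝ] F₂, fun x => V₁ x →L[ℝ] V₂ x⟯) :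
    Cₛ^∞⟮I; F₁ →L[ℝ] F₃, fun x => V₁ x →L[ℝ] V₃ x⟯ :=
  ⟨fun x => (S x).comp (T x), by
    intro x₀
    have hS := (contMDiffAt_hom_bundle _).1 (S.contMDiff x₀)
    have hT := (contMDiffAt_hom_bundle _).1 (T.contMDiff x₀)
    refine (contMDiffAt_hom_bundle _).2 ⟨hS.1, ?_⟩
    refine (hS.2.clm_comp hT.2).congr_of_eventuallyEq ?_
    filter_upwards [(trivializationAt F₂ V₂ x₀).open_baseSet.mem_nhds
      (FiberBundle.mem_baseSet_trivializationAt' x₀)] with x hx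
    ext v
    simp [ContinuousLinearMap.inCoordinates, hx]⟩

end Composition

/-! ### Lie algebroids -/

section Main

variable {E : Type*} [NormedAddCommGroup E] [NormedSpace ℝ E]
  {H : Type*} [TopologicalSpace H] (I : ModelWithCorners ℝ E H)
  {M : Type*} [TopologicalSpace M] [ChartedSpace H M]
  (F : Type*) [NormedAddCommGroup F] [NormedSpace ℝ F]
  (V : M → Type*) [TopologicalSpace (TotalSpace F V)]
  [∀ x, AddCommGroup (V x)] [∀ x, Module ℝ (V x)] [∀ x, TopologicalSpace (V x)]
  [∀ x, IsTopologicalAddGroup (V x)] [∀ x, ContinuousSMul ℝ (V x)]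
  [FiberBundle F V] [VectorBundle ℝ F V]

/-- The fibre at `x` of the dual bundle `A^*`. -/
abbrev Dual (x : M) : Type _ := V x →L[ℝ] Bundle.Trivial M ℝ x

/-- Smooth sections of `A`. -/
abbrev Sec := Cₛ^∞⟮I; F, V⟯

/-- `1`-forms on `A`: smooth sections of `A^*`. -/
abbrev OneForm := Cₛ^∞⟮I; F →L[ℝ] ℝ, fun x => Dual V x⟯

/-- `(1,1)`-tensors on `A`: smooth vector bundle endomorphisms. -/
abbrev EndField := Cₛ^∞⟮I; F →L[ℝ] F, fun x => V x →L[ℝ] V x⟯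

/-- A `2`-form on `A`: a smooth section `x ↦ Ω_x` of skew-symmetric bilinear forms on the
fibres of `A`, where `Ω x u v` is `Ω_x(u, v)`. -/
structure TwoForm where
  form : Cₛ^∞⟮I; F →L[ℝ] F →L[ℝ] ℝ, fun x => V x →L[ℝ] Dual V x⟯
  skew : ∀ (x : M) (u v : V x), form x u v = -form x v u

/-- A bivector on `A`, that is, a smooth section of `∧² A`, identified (the rank of `A` being
finite) with the smooth bundle map `P^♯ : A^* → A`, `⟨β, P^♯ α⟩ = P(α, β)`, which is
skew-symmetric. -/
structure Bivector where
  sharp : Cₛ^∞⟮I; (F →L[ℝ] ℝ) →L[ℝ] F, fun x => Dual V x →L[ℝ] V x⟯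
  skew : ∀ (x : M) (α β : Dual V x), β (sharp x α) = -α (sharp x β)

variable {I F V}

/-- The derivative of `f` at `x` along the tangent vector `v`. -/
def dirDeriv (f : M → ℝ) (x : M) (v : TangentSpace I x) : ℝ := mfderiv I 𝓘(ℝ, ℝ) f x v

/-- The product `f X` of a smooth function and a smooth section. -/
def smulSec (f : C^∞⟮I, M; ℝ⟯) (X : Sec I F V) : Sec I F V :=
  ⟨fun x => f x • X x, f.contMDiff.smul_section X.contMDiff⟩

/-- `X ↦ N X` on smooth sections. -/
def applyEnd (N : EndField I F V) : Sec I F V →ₗ[ℝ] Sec I F V where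
  toFun X := applySec N X
  map_add' X Y := by ext x; simp [applySec]
  map_smul' c X := by ext x; simp [applySec]

/-- `α ↦ N^* α = α ∘ N` on `1`-forms. -/
def transpose (N : EndField I F V) (α : OneForm I F V) : OneForm I F V :=
  compSec α N

variable (I F V) in
/-- A bracket with anchor on `A`: an anchor `ρ : A → TM`, a smooth bundle map, and a
skew-symmetric `ℝ`-bilinear bracket of smooth sections with
`[X, f Y] = f [X, Y] + (ρ(X) f) Y`. (In graded language: an element of bidegree `(1, 2)` of
the functions on `T^*[2]A[1]`, with no condition on its square.) -/
structure SkewAlgebroid [IsManifold I ∞ M] where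
  anchor : Cₛ^∞⟮I; F →L[ℝ] E, fun x => V x →L[ℝ] TangentSpace I x⟯
  bracket : Sec I F V →ₗ[ℝ] Sec I F V →ₗ[ℝ] Sec I F V
  bracket_self : ∀ X, bracket X X = 0
  leibniz : ∀ (X : Sec I F V) (f : C^∞⟮I, M; ℝ⟯) (Y : Sec I F V) (x : M),
    bracket X (smulSec f Y) x =
      f x • bracket X Y x + dirDeriv f x (anchor x (X x)) • Y x

variable (I F V) in
/-- A Lie algebroid structure on `A`: the bracket satisfies in addition the Jacobi identity. -/
structure LieAlgebroid [IsManifold I ∞ M] extends SkewAlgebroid I F V where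
  jacobi : ∀ X Y Z : Sec I F V,
    bracket X (bracket Y Z) = bracket (bracket X Y) Z + bracket Y (bracket X Z)

/-! ### Tensors -/

namespace TwoForm

/-- The function `Ω(X, Y)`. -/
def eval (Ω : TwoForm I F V) (X Y : Sec I F V) (x : M) : ℝ := Ω.form x (X x) (Y x)

/-- `Ω^♭ X = - i_X Ω`. -/
def flat (Ω : TwoForm I F V) : Cₛ^∞⟮I; F →L[ℝ] F →L[ℝ] ℝ, fun x => V x →L[ℝ] Dual V x⟯ :=
  ⟨fun x => -Ω.form x, Ω.form.contMDiff.neg_section⟩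

/-- If `Ω^♭ ∘ N = N^* ∘ Ω^♭`, the `2`-form `Ω_N` with `Ω_N^♭ = Ω^♭ ∘ N`. -/
def twist (Ω : TwoForm I F V) (N : EndField I F V)
    (h : ∀ (x : M) (u : V x), Ω.flat x (N x u) = (Ω.flat x u).comp (N x)) :
    TwoForm I F V where
  form := compSec Ω.form N
  skew x u v := by
    have h1 := congrArg (fun φ : Dual V x => φ v) (h x u)
    have h2 : Ω.form x (N x u) v = Ω.form x u (N x v) := neg_injective h1
    have h3 : Ω.form x u (N x v) = -Ω.form x (N x v) u := Ω.skew x _ _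
    exact h2.trans h3

theorem flat_twist (Ω : TwoForm I F V) (N : EndField I F V)
    (h : ∀ (x : M) (u : V x), Ω.flat x (N x u) = (Ω.flat x u).comp (N x)) (x : M) (u : V x) :
    (Ω.twist N h).flat x u = Ω.flat x (N x u) := rfl

end TwoForm

namespace Bivector

/-- The function `P(α, β) = ⟨β, P^♯ α⟩`. -/
def eval (P : Bivector I F V) (α β : OneForm I F V) (x : M) : ℝ := β x (P.sharp x (α x))

/-- `P` is non-degenerate if `P^♯` is an isomorphism on each fibre. -/
def Nondegenerate (P : Bivector I F V) : Prop :=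
  ∀ x : M, Function.Bijective (P.sharp x)

/-- The isomorphism `P^♯` of a non-degenerate bivector, on the fibre at `x`. -/
def sharpEquiv (P : Bivector I F V) (h : P.Nondegenerate) (x : M) : Dual V x ≃ₗ[ℝ] V x :=
  LinearEquiv.ofBijective (P.sharp x).toLinearMap (h x)

/-- The `(1,1)`-tensor `P^♯ ∘ Ω^♭`. -/
def compFlat (P : Bivector I F V) (Ω : TwoForm I F V) : EndField I F V :=
  compSec P.sharp Ω.flat

theorem compFlat_comm (P : Bivector I F V) (Ω : TwoForm I F V) (x : M) (u : V x) :
    Ω.flat x (P.compFlat Ω x u) = (Ω.flat x u).comp (P.compFlat Ω x) := by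
  ext v
  have h1 : Ω.form x (P.sharp x (Ω.flat x u)) v = -Ω.form x v (P.sharp x (Ω.flat x u)) :=
    Ω.skew x _ _
  have h2 : Ω.flat x v (P.sharp x (Ω.flat x u)) = -Ω.flat x u (P.sharp x (Ω.flat x v)) :=
    P.skew x _ _
  change -Ω.form x (P.sharp x (Ω.flat x u)) v = Ω.flat x u (P.sharp x (Ω.flat x v))
  rw [h1, neg_neg]
  exact neg_injective h2

end Bivector

/-! ### Differential calculus of a bracket with anchor -/

namespace SkewAlgebroid

variable [IsManifold I ∞ M]

/-- The function `ρ(X) f`. -/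
def deriv (μ : SkewAlgebroid I F V) (X : Sec I F V) (f : M → ℝ) (x : M) : ℝ :=
  dirDeriv f x (μ.anchor x (X x))

/-- The function `⟨L_X α, Y⟩ = ρ(X)⟨α, Y⟩ - ⟨α, [X, Y]⟩`. -/
def lieDeriv (μ : SkewAlgebroid I F V) (X : Sec I F V) (α : OneForm I F V) (Y : Sec I F V)
    (x : M) : ℝ :=
  μ.deriv X (fun y => α y (Y y)) x - α x (μ.bracket X Y x)

/-- The function `(d_μ Ω)(X, Y, Z)`. -/
def d (μ : SkewAlgebroid I F V) (Ω : TwoForm I F V) (X Y Z : Sec I F V) (x : M) : ℝ :=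
  μ.deriv X (Ω.eval Y Z) x - μ.deriv Y (Ω.eval X Z) x + μ.deriv Z (Ω.eval X Y) x
    - Ω.eval (μ.bracket X Y) Z x + Ω.eval (μ.bracket X Z) Y x - Ω.eval (μ.bracket Y Z) X x

/-- `Ω` is `d_μ`-closed. -/
def IsClosed (μ : SkewAlgebroid I F V) (Ω : TwoForm I F V) : Prop :=
  ∀ (X Y Z : Sec I F V) (x : M), μ.d Ω X Y Z x = 0

/-- The Koszul bracket of `1`-forms
`[α, β]_P = L_{P^♯ α} β - L_{P^♯ β} α - d_μ (P(α, β))`, evaluated on the section `X`. -/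
def koszul (μ : SkewAlgebroid I F V) (P : Bivector I F V) (α β : OneForm I F V)
    (X : Sec I F V) (x : M) : ℝ :=
  μ.lieDeriv (applySec P.sharp α) β X x - μ.lieDeriv (applySec P.sharp β) α X x
    - μ.deriv X (P.eval α β) x

/-- The Schouten bracket `[P, Q]_μ` of bivectors, evaluated on `1`-forms. It is `d_P Q`, where
`d_P = [P, ·]_μ` is the differential on multivectors defined by the anchor `ρ ∘ P^♯` and the
bracket `[α, β]_P` on `A^*`; so it is the cyclic sum over `(α, β, γ)` of
`ρ(P^♯ α) (Q(β, γ)) - Q([α, β]_P, γ)`, in which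
`Q([α, β]_P, γ) = - ⟨[α, β]_P, Q^♯ γ⟩`. -/
def schouten (μ : SkewAlgebroid I F V) (P Q : Bivector I F V) (α β γ : OneForm I F V)
    (x : M) : ℝ :=
  (μ.deriv (applySec P.sharp α) (Q.eval β γ) x
      + μ.koszul P α β (applySec Q.sharp γ) x)
    + (μ.deriv (applySec P.sharp β) (Q.eval γ α) x
      + μ.koszul P β γ (applySec Q.sharp α) x)
    + (μ.deriv (applySec P.sharp γ) (Q.eval α β) x
      + μ.koszul P γ α (applySec Q.sharp β) x)

/-- `P` is a Poisson bivector: `[P, P]_μ = 0`. -/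
def IsPoisson (μ : SkewAlgebroid I F V) (P : Bivector I F V) : Prop :=
  ∀ (α β γ : OneForm I F V) (x : M), μ.schouten P P α β γ x = 0

/-- The deformed structure `μ_N`, with anchor `ρ ∘ N` and bracket
`[X, Y]_N = [N X, Y] + [X, N Y] - N [X, Y]`. -/
def deform (μ : SkewAlgebroid I F V) (N : EndField I F V) : SkewAlgebroid I F V where
  anchor := compSec μ.anchor N
  bracket := μ.bracket ∘ₗ applyEnd N + μ.bracket.compl₂ (applyEnd N)
    - μ.bracket.compr₂ (applyEnd N)
  bracket_self X := by
    have h := μ.bracket_self (X + applyEnd N X)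
    simp only [map_add, LinearMap.add_apply, μ.bracket_self, zero_add, add_zero] at h
    simp only [LinearMap.sub_apply, LinearMap.add_apply, LinearMap.comp_apply,
      LinearMap.compl₂_apply, LinearMap.compr₂_apply, μ.bracket_self, map_zero, sub_zero]
    exact h
  leibniz X f Y x := by
    have hN : applyEnd N (smulSec f Y) = smulSec f (applyEnd N Y) := by
      ext y
      simp [applyEnd, applySec, smulSec]
    have h1 := μ.leibniz (applyEnd N X) f Y x
    have h2 := μ.leibniz X f (applyEnd N Y) x
    have h3 := congrArg (N x) (μ.leibniz X f Y x)
    rw [map_add, map_smul, map_smul] at h3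
    change μ.bracket (applyEnd N X) (smulSec f Y) x
        + μ.bracket X (applyEnd N (smulSec f Y)) x - N x (μ.bracket X (smulSec f Y) x)
      = f x • (μ.bracket (applyEnd N X) Y x + μ.bracket X (applyEnd N Y) x
          - N x (μ.bracket X Y x))
        + dirDeriv f x (μ.anchor x (N x (X x))) • Y x
    rw [hN, h1, h2, h3, smul_sub, smul_add]
    change _ + dirDeriv f x (μ.anchor x (N x (X x))) • Y x
      + (_ + dirDeriv f x (μ.anchor x (X x)) • N x (Y x)) - _ = _
    abel

/-- The Nijenhuis torsion
`(T_μ N)(X, Y) = [N X, N Y] - N ([N X, Y] + [X, N Y]) + N² [X, Y]`. -/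
def torsion (μ : SkewAlgebroid I F V) (N : EndField I F V) (X Y : Sec I F V) : Sec I F V :=
  μ.bracket (applyEnd N X) (applyEnd N Y)
    - applyEnd N (μ.bracket (applyEnd N X) Y + μ.bracket X (applyEnd N Y))
    + applyEnd N (applyEnd N (μ.bracket X Y))

/-- `N` is a Nijenhuis tensor. -/
def IsNijenhuis (μ : SkewAlgebroid I F V) (N : EndField I F V) : Prop :=
  ∀ X Y : Sec I F V, μ.torsion N X Y = 0

/-- `⟨C_μ(P, N)(α, β), X⟩`: the difference of the bracket on `A^*` obtained from `μ_N` by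
means of `P`, and of the bracket `[α, β]_P` deformed by `N^*`,
`[N^* α, β]_P + [α, N^* β]_P - N^* [α, β]_P`. -/
def concomitant (μ : SkewAlgebroid I F V) (P : Bivector I F V) (N : EndField I F V)
    (α β : OneForm I F V) (X : Sec I F V) (x : M) : ℝ :=
  (μ.deform N).koszul P α β X x
    - (μ.koszul P (transpose N α) β X x + μ.koszul P α (transpose N β) X x
      - μ.koszul P α β (applyEnd N X) x)

/-- `P` and `N` are compatible: `N ∘ P^♯ = P^♯ ∘ N^*` and `C_μ(P, N) = 0`. -/
structure Compatible (μ : SkewAlgebroid I F V) (P : Bivector I F V) (N : EndField I F V) :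
    Prop where
  comm : ∀ (x : M) (α : Dual V x), N x (P.sharp x α) = P.sharp x (α.comp (N x))
  concomitant_eq_zero : ∀ (α β : OneForm I F V) (X : Sec I F V) (x : M),
    μ.concomitant P N α β X x = 0

end SkewAlgebroid

/-! ### Composite structures on a Lie algebroid -/

namespace LieAlgebroid

variable [IsManifold I ∞ M]

/-- `(P, N)` is a `PN`-structure on `(A, μ)`. -/
structure IsPN (μ : LieAlgebroid I F V) (P : Bivector I F V) (N : EndField I F V) : Prop where
  poisson : μ.IsPoisson P
  nijenhuis : μ.IsNijenhuis N
  compatible : μ.Compatible P N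

/-- `(P, Ω)` is a `PΩ`-structure on `(A, μ)`: `P` is Poisson, `d_μ Ω = 0` and
`d_μ (Ω_N) = 0`, where `N = P^♯ ∘ Ω^♭`. -/
structure IsPOmega (μ : LieAlgebroid I F V) (P : Bivector I F V) (Ω : TwoForm I F V) :
    Prop where
  poisson : μ.IsPoisson P
  closed : μ.IsClosed Ω
  closed_twist : μ.IsClosed (Ω.twist (P.compFlat Ω) (P.compFlat_comm Ω))

end LieAlgebroid

end Main

end LieAlgd

end

/-!
With `N = P^♯ ∘ Ω^♭`, both conditions that make `(P, N)` a `PN`-structure are expressed through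
`[P, P]`, `d Ω` and `d Ω_N` by identities valid for every bivector `P` and `2`-form `Ω`, whether
or not the bracket satisfies the Jacobi identity:

* `torsion_compFlat`:
  `⟨γ, T N (X, Y)⟩ = ½ [P, P](Ω^♭ X, Ω^♭ Y, γ) - d Ω_N (X, Y, P^♯ γ)`
  `+ d Ω (N X, Y, P^♯ γ) + d Ω (X, N Y, P^♯ γ)`;
* `concomitant_compFlat`:
  `⟨C(P, N)(α, β), X⟩ = 2 d Ω (X, P^♯ α, P^♯ β) + [P, P](α, β, Ω^♭ X)`.

They follow from the fact that `½ [P, P]` measures how far `P^♯` is from intertwining the Koszul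
bracket and the bracket of `A` (`schouten_self_eq_defect`), and from a computation of
`[Ω^♭ X, Ω^♭ Y]_P` (`koszul_flat`). The Koszul bracket is only ever paired with sections of `A`.

If `(P, Ω)` is a `PΩ`-structure, the right-hand sides vanish; the torsion is then zero because
`1`-forms separate the vectors of a fibre (`eq_zero_of_forall_oneForm_apply_eq_zero`).
Conversely, if `P` is non-degenerate, its fibrewise inverse is smooth (`invSec`), so that
`Ω^♭ = (P^♯)⁻¹ ∘ N` is smooth, and it is skew-symmetric since `N ∘ P^♯ = P^♯ ∘ N^*`. Every section
is of the form `P^♯ γ`, and the same two identities give `d Ω = 0`, then `d Ω_N = 0`.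
-/

noncomputable section

namespace LieAlgd

/-! ### Koszul bracket, torsion and concomitant -/

section Identities

variable {E : Type*} [NormedAddCommGroup E] [NormedSpace ℝ E]
  {H : Type*} [TopologicalSpace H] {I : ModelWithCorners ℝ E H}
  {M : Type*} [TopologicalSpace M] [ChartedSpace H M] [IsManifold I ∞ M]
  {F : Type*} [NormedAddCommGroup F] [NormedSpace ℝ F]
  {V : M → Type*} [TopologicalSpace (TotalSpace F V)]
  [∀ x, AddCommGroup (V x)] [∀ x, Module ℝ (V x)] [∀ x, TopologicalSpace (V x)]
  [∀ x, IsTopologicalAddGroup (V x)] [∀ x, ContinuousSMul ℝ (V x)]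
  [FiberBundle F V] [VectorBundle ℝ F V]

/-- Both sides are `P^♯ ∘ Ω^♭ ∘ P^♯`, by skew-symmetry of `P` and `Ω`. -/
theorem Bivector.compFlat_sharp (P : Bivector I F V) (Ω : TwoForm I F V) (x : M) (α : Dual V x) :
    P.compFlat Ω x (P.sharp x α) = P.sharp x (α.comp (P.compFlat Ω x)) := by
  change P.sharp x (Ω.flat x (P.sharp x α)) = _
  congr 1
  ext v
  have h1 : Ω.form x (P.sharp x α) v = -Ω.form x v (P.sharp x α) := Ω.skew x _ _
  have h2 : α (P.sharp x (Ω.flat x v)) = -Ω.flat x v (P.sharp x α) := P.skew x _ _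
  change -Ω.form x (P.sharp x α) v = α (P.sharp x (Ω.flat x v))
  rw [h1, h2]
  rfl

namespace SkewAlgebroid

variable (μ : SkewAlgebroid I F V)

theorem deriv_neg (X : Sec I F V) (f : M → ℝ) (x : M) :
    μ.deriv X (fun y => -f y) x = -μ.deriv X f x := by
  have h := mfderiv_neg (I := I) (f := f) (x := x)
  exact congrArg (fun T : TangentSpace I x →L[ℝ] ℝ => T (μ.anchor x (X x))) h

theorem bracket_swap (X Y : Sec I F V) : μ.bracket X Y = -μ.bracket Y X := by
  have h := μ.bracket_self (X + Y)
  simp only [map_add, LinearMap.add_apply, μ.bracket_self, zero_add, add_zero] at h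
  exact eq_neg_of_add_eq_zero_right h

theorem deriv_eval_swap (P : Bivector I F V) (X : Sec I F V) (α β : OneForm I F V) (x : M) :
    μ.deriv X (P.eval α β) x = -μ.deriv X (P.eval β α) x := by
  rw [← μ.deriv_neg]
  exact congrArg (fun f => μ.deriv X f x) (funext fun y => P.skew y (α y) (β y))

theorem eval_bracket_swap (α : OneForm I F V) (X Y : Sec I F V) (x : M) :
    α x (μ.bracket X Y x) = -α x (μ.bracket Y X x) := by
  rw [μ.bracket_swap X Y]
  exact map_neg (α x) _

theorem koszul_sharp (P : Bivector I F V) (α β γ : OneForm I F V) (x : M) :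
    μ.koszul P α β (applySec P.sharp γ) x =
      α x (μ.bracket (applySec P.sharp β) (applySec P.sharp γ) x)
      + β x (μ.bracket (applySec P.sharp γ) (applySec P.sharp α) x)
      - (μ.deriv (applySec P.sharp α) (P.eval β γ) x
        + μ.deriv (applySec P.sharp β) (P.eval γ α) x
        + μ.deriv (applySec P.sharp γ) (P.eval α β) x) := by
  rw [μ.deriv_eval_swap P _ β γ, μ.eval_bracket_swap β (applySec P.sharp γ)]
  change (μ.deriv (applySec P.sharp α) (P.eval γ β) x
      - β x (μ.bracket (applySec P.sharp α) (applySec P.sharp γ) x))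
    - (μ.deriv (applySec P.sharp β) (P.eval γ α) x
      - α x (μ.bracket (applySec P.sharp β) (applySec P.sharp γ) x))
    - μ.deriv (applySec P.sharp γ) (P.eval α β) x = _
  ring

/-- The terms with derivatives add up to `3 - 1 = 2` copies of the cyclic sum of
`ρ(P^♯ α) (P(β, γ))`. -/
theorem schouten_self_eq_cyclic (P : Bivector I F V) (α β γ : OneForm I F V) (x : M) :
    μ.schouten P P α β γ x =
      2 * (α x (μ.bracket (applySec P.sharp β) (applySec P.sharp γ) x)
      + β x (μ.bracket (applySec P.sharp γ) (applySec P.sharp α) x)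
      + γ x (μ.bracket (applySec P.sharp α) (applySec P.sharp β) x)
      - (μ.deriv (applySec P.sharp α) (P.eval β γ) x
        + μ.deriv (applySec P.sharp β) (P.eval γ α) x
        + μ.deriv (applySec P.sharp γ) (P.eval α β) x)) := by
  rw [schouten, koszul_sharp, koszul_sharp, koszul_sharp]
  ring

/-- Up to the factor `2`, the Schouten bracket `[P, P]` is the defect of `P^♯` from being a
morphism of brackets, `⟨γ, [P^♯ α, P^♯ β] - P^♯ [α, β]_P⟩`. -/
theorem schouten_self_eq_defect (P : Bivector I F V) (α β γ : OneForm I F V) (x : M) :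
    μ.schouten P P α β γ x =
      2 * (γ x (μ.bracket (applySec P.sharp α) (applySec P.sharp β) x)
        + μ.koszul P α β (applySec P.sharp γ) x) := by
  rw [schouten_self_eq_cyclic, koszul_sharp]
  ring

/-- If `N ∘ P^♯ = P^♯ ∘ N^*`, the derivatives along `N P^♯ α`, `N P^♯ β`, `P^♯ α` and `P^♯ β`
cancel in the concomitant of `P` and `N`; every remaining term occurs twice. -/
theorem concomitant_eq (P : Bivector I F V) (N : EndField I F V)
    (hN : ∀ (x : M) (α : Dual V x), N x (P.sharp x α) = P.sharp x (α.comp (N x)))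
    (α β : OneForm I F V) (X : Sec I F V) (x : M) :
    μ.concomitant P N α β X x =
      2 * (μ.deriv X (P.eval (transpose N α) β) x - μ.deriv (applyEnd N X) (P.eval α β) x
        + β x (N x (μ.bracket (applySec P.sharp α) X x))
        - β x (μ.bracket (applySec P.sharp α) (applyEnd N X) x)
        + α x (μ.bracket (applySec P.sharp β) (applyEnd N X) x)
        - α x (N x (μ.bracket (applySec P.sharp β) X x))) := by
  have hs (α : OneForm I F V) :
      applySec P.sharp (transpose N α) = applyEnd N (applySec P.sharp α) :=
    ContMDiffSection.ext fun y => (hN y (α y)).symm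
  have he : P.eval α (transpose N β) = P.eval (transpose N α) β :=
    funext fun y => congrArg (β y) (hN y (α y))
  have hb (ξ : OneForm I F V) (Y : Sec I F V) :
      ξ x ((μ.deform N).bracket Y X x) =
        ξ x (μ.bracket (applyEnd N Y) X x) + ξ x (μ.bracket Y (applyEnd N X) x)
          - ξ x (N x (μ.bracket Y X x)) :=
    (map_sub (ξ x) _ _).trans (congrArg (· - _) (map_add (ξ x) _ _))
  have h1 : (μ.deform N).koszul P α β X x =
      (μ.deriv (applyEnd N (applySec P.sharp α)) (fun y => β y (X y)) x
        - β x ((μ.deform N).bracket (applySec P.sharp α) X x))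
      - (μ.deriv (applyEnd N (applySec P.sharp β)) (fun y => α y (X y)) x
        - α x ((μ.deform N).bracket (applySec P.sharp β) X x))
      - μ.deriv (applyEnd N X) (P.eval α β) x := rfl
  rw [concomitant, h1, hb, hb]
  simp only [koszul, lieDeriv, hs, he]
  change _ - ((_ - (_ - α x (N x (μ.bracket (applySec P.sharp β) X x))) - _)
    + ((_ - β x (N x (μ.bracket (applySec P.sharp α) X x))) - _ - _) - _) = _
  have e1 : (fun y => (transpose N α) y (X y)) = fun y => α y ((applyEnd N X) y) := rfl
  have e2 : (fun y => (transpose N β) y (X y)) = fun y => β y ((applyEnd N X) y) := rfl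
  rw [e1, e2]
  ring

theorem deriv_form_swap (Ω : TwoForm I F V) (X Y Z : Sec I F V) (x : M) :
    μ.deriv X (Ω.eval Y Z) x = -μ.deriv X (Ω.eval Z Y) x := by
  rw [← μ.deriv_neg]
  exact congrArg (fun f => μ.deriv X f x) (funext fun y => Ω.skew y (Y y) (Z y))

/-- `[Ω^♭ X, Ω^♭ Y]_P = Ω^♭ [X, Y]_N` up to terms in `d Ω` and `d Ω_N`, where
`N = P^♯ ∘ Ω^♭` and `[X, Y]_N` is the bracket of `μ_N`. No condition on `P` enters. -/
theorem koszul_flat (P : Bivector I F V) (Ω : TwoForm I F V) (X Y Z : Sec I F V) (x : M) :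
    μ.koszul P (applySec Ω.flat X) (applySec Ω.flat Y) Z x =
      μ.d (Ω.twist (P.compFlat Ω) (P.compFlat_comm Ω)) X Y Z x
        - μ.d Ω (applyEnd (P.compFlat Ω) X) Y Z x - μ.d Ω X (applyEnd (P.compFlat Ω) Y) Z x
        + Ω.flat x ((μ.deform (P.compFlat Ω)).bracket X Y x) (Z x) := by
  let Ω' := Ω.twist (P.compFlat Ω) (P.compFlat_comm Ω)
  have hcomm (y : M) (u v : V y) :
      Ω.form y u (P.compFlat Ω y v) = Ω.form y (P.compFlat Ω y u) v := by
    have h := congrArg (fun φ : Dual V y => φ v) (P.compFlat_comm Ω y u)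
    exact (neg_injective h).symm
  have hN (X Y : Sec I F V) : Ω.eval X (applyEnd (P.compFlat Ω) Y) = Ω'.eval X Y :=
    funext fun y => hcomm y (X y) (Y y)
  have hN' (X Y : Sec I F V) : Ω.eval (applyEnd (P.compFlat Ω) X) Y = Ω'.eval X Y := rfl
  have hskew (X Y : Sec I F V) : Ω.eval X Y x = -Ω.eval Y X x := Ω.skew x (X x) (Y x)
  have hflat (W X Y : Sec I F V) :
      μ.deriv W (fun y => (applySec Ω.flat X) y (Y y)) x = -μ.deriv W (Ω.eval X Y) x :=
    μ.deriv_neg W (Ω.eval X Y) x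
  have hsharp (X : Sec I F V) :
      applySec P.sharp (applySec Ω.flat X) = applyEnd (P.compFlat Ω) X := rfl
  -- `P(Ω^♭ X, Ω^♭ Y) = -Ω(Y, N X)`
  have hP : μ.deriv Z (P.eval (applySec Ω.flat X) (applySec Ω.flat Y)) x
      = μ.deriv Z (Ω'.eval X Y) x := by
    have h : μ.deriv Z (P.eval (applySec Ω.flat X) (applySec Ω.flat Y)) x
        = -μ.deriv Z (Ω.eval Y (applyEnd (P.compFlat Ω) X)) x := μ.deriv_neg Z _ x
    rw [h, hN, μ.deriv_form_swap, neg_neg]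
  have hval (X W : Sec I F V) : (applySec Ω.flat X) x (W x) = -Ω.eval X W x := rfl
  have hdef : Ω.flat x ((μ.deform (P.compFlat Ω)).bracket X Y x) (Z x) =
      -(Ω.eval (μ.bracket (applyEnd (P.compFlat Ω) X) Y) Z x
        + Ω.eval (μ.bracket X (applyEnd (P.compFlat Ω) Y)) Z x
        - Ω'.eval (μ.bracket X Y) Z x) := by
    have h : (μ.deform (P.compFlat Ω)).bracket X Y x = μ.bracket (applyEnd (P.compFlat Ω) X) Y x
        + μ.bracket X (applyEnd (P.compFlat Ω) Y) x - P.compFlat Ω x (μ.bracket X Y x) := rfl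
    rw [h, map_sub, map_add]
    change -Ω.eval (μ.bracket (applyEnd (P.compFlat Ω) X) Y) Z x
      + -Ω.eval (μ.bracket X (applyEnd (P.compFlat Ω) Y)) Z x - -Ω'.eval (μ.bracket X Y) Z x = _
    ring
  change _ = μ.d Ω' X Y Z x - _ - _ + _
  simp only [koszul, lieDeriv, d, hflat, hsharp, hval, hP, hdef, hN, hN']
  rw [hskew X, hskew Y]
  ring

/-- Since `T N (X, Y) = [N X, N Y] - N [X, Y]_N` and `N X = P^♯ (Ω^♭ X)`, the torsion compares
`[P^♯ Ω^♭ X, P^♯ Ω^♭ Y]` with `P^♯ [Ω^♭ X, Ω^♭ Y]_P`, up to the terms of `koszul_flat`. -/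
theorem torsion_compFlat (P : Bivector I F V) (Ω : TwoForm I F V) (X Y : Sec I F V)
    (γ : OneForm I F V) (x : M) :
    γ x (μ.torsion (P.compFlat Ω) X Y x) =
      μ.schouten P P (applySec Ω.flat X) (applySec Ω.flat Y) γ x / 2
        - μ.d (Ω.twist (P.compFlat Ω) (P.compFlat_comm Ω)) X Y (applySec P.sharp γ) x
        + μ.d Ω (applyEnd (P.compFlat Ω) X) Y (applySec P.sharp γ) x
        + μ.d Ω X (applyEnd (P.compFlat Ω) Y) (applySec P.sharp γ) x := by
  have hskew : γ x (P.compFlat Ω x ((μ.deform (P.compFlat Ω)).bracket X Y x))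
      = -Ω.flat x ((μ.deform (P.compFlat Ω)).bracket X Y x) (P.sharp x (γ x)) :=
    P.skew x _ _
  have htors : μ.torsion (P.compFlat Ω) X Y x =
      μ.bracket (applyEnd (P.compFlat Ω) X) (applyEnd (P.compFlat Ω) Y) x
        - P.compFlat Ω x ((μ.deform (P.compFlat Ω)).bracket X Y x) := by
    have h : (μ.deform (P.compFlat Ω)).bracket X Y x =
      (μ.bracket (applyEnd (P.compFlat Ω) X) Y + μ.bracket X (applyEnd (P.compFlat Ω) Y)) x
        - P.compFlat Ω x (μ.bracket X Y x) := rfl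
    rw [h, map_sub, ← sub_add]
    rfl
  rw [htors, map_sub, hskew, schouten_self_eq_defect, koszul_flat]
  have hs (X : Sec I F V) :
      applySec P.sharp (applySec Ω.flat X) = applyEnd (P.compFlat Ω) X := rfl
  have hγ : (applySec P.sharp γ) x = P.sharp x (γ x) := rfl
  rw [hs, hs, hγ]
  ring

/-- The terms of the concomitant with a derivative along `N X` or a bracket with
`N X = P^♯ (Ω^♭ X)` belong to `[P, P](α, β, Ω^♭ X)`; what is then left is
`2 (d Ω)(X, P^♯ α, P^♯ β)`. -/
theorem concomitant_compFlat (P : Bivector I F V) (Ω : TwoForm I F V) (α β : OneForm I F V)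
    (X : Sec I F V) (x : M) :
    μ.concomitant P (P.compFlat Ω) α β X x =
      2 * μ.d Ω X (applySec P.sharp α) (applySec P.sharp β) x
        + μ.schouten P P α β (applySec Ω.flat X) x := by
  have hskew (X Y : Sec I F V) : Ω.eval X Y x = -Ω.eval Y X x := Ω.skew x (X x) (Y x)
  have hflat (ξ : OneForm I F V) (u : V x) :
      ξ x (P.compFlat Ω x u) = -Ω.flat x u (P.sharp x (ξ x)) := P.skew x _ _
  have hN1 (ξ η : OneForm I F V) :
      ξ x (P.compFlat Ω x (μ.bracket (applySec P.sharp η) X x)) =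
        Ω.eval (μ.bracket (applySec P.sharp η) X) (applySec P.sharp ξ) x :=
    (hflat ξ _).trans (neg_neg _)
  -- `P(N^* α, β) = ⟨β, N P^♯ α⟩ = Ω(P^♯ α, P^♯ β)`
  have hP : P.eval (transpose (P.compFlat Ω) α) β
      = Ω.eval (applySec P.sharp α) (applySec P.sharp β) := by
    funext y
    have h1 : P.eval (transpose (P.compFlat Ω) α) β y
        = β y (P.compFlat Ω y (P.sharp y (α y))) := congrArg (β y) (P.compFlat_sharp Ω y (α y)).symm
    have h2 : β y (P.compFlat Ω y (P.sharp y (α y)))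
        = -Ω.flat y (P.sharp y (α y)) (P.sharp y (β y)) := P.skew y _ _
    exact (h1.trans h2).trans (neg_neg _)
  have hd1 : μ.deriv (applySec P.sharp α) (P.eval β (applySec Ω.flat X)) x =
      -μ.deriv (applySec P.sharp α) (Ω.eval X (applySec P.sharp β)) x := μ.deriv_neg _ _ x
  have hd2 : μ.deriv (applySec P.sharp β) (P.eval α (applySec Ω.flat X)) x =
      -μ.deriv (applySec P.sharp β) (Ω.eval X (applySec P.sharp α)) x := μ.deriv_neg _ _ x
  have hs : applySec P.sharp (applySec Ω.flat X) = applyEnd (P.compFlat Ω) X := rfl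
  have hX : (applySec Ω.flat X) x (μ.bracket (applySec P.sharp α) (applySec P.sharp β) x)
      = -Ω.eval X (μ.bracket (applySec P.sharp α) (applySec P.sharp β)) x := rfl
  have hb (Y Z : Sec I F V) : Ω.eval (μ.bracket X Y) Z x = -Ω.eval (μ.bracket Y X) Z x := by
    rw [μ.bracket_swap X Y]
    exact congrArg (fun φ : Dual V x => φ (Z x)) (map_neg (Ω.form x) _)
  rw [concomitant_eq _ _ _ (P.compFlat_sharp Ω), schouten_self_eq_cyclic, hs, hN1, hN1, hP, hX, hd1,
    μ.deriv_eval_swap P _ (applySec Ω.flat X) α, hd2,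
    μ.eval_bracket_swap β (applyEnd (P.compFlat Ω) X), hskew X, d, hb, hb]
  ring

end SkewAlgebroid

end Identities

/-! ### Extension of vectors to sections, and inverses of bundle maps -/

section Bundles

variable {E : Type*} [NormedAddCommGroup E] [NormedSpace ℝ E]
  {H : Type*} [TopologicalSpace H] {I : ModelWithCorners ℝ E H}
  {M : Type*} [TopologicalSpace M] [ChartedSpace H M]
  {F₁ F₂ : Type*} [NormedAddCommGroup F₁] [NormedSpace ℝ F₁]
  [NormedAddCommGroup F₂] [NormedSpace ℝ F₂]
  {V₁ : M → Type*} [TopologicalSpace (TotalSpace F₁ V₁)]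
  [∀ x, AddCommGroup (V₁ x)] [∀ x, Module ℝ (V₁ x)] [∀ x, TopologicalSpace (V₁ x)]
  [∀ x, IsTopologicalAddGroup (V₁ x)] [∀ x, ContinuousSMul ℝ (V₁ x)]
  [FiberBundle F₁ V₁] [VectorBundle ℝ F₁ V₁]
  {V₂ : M → Type*} [TopologicalSpace (TotalSpace F₂ V₂)]
  [∀ x, AddCommGroup (V₂ x)] [∀ x, Module ℝ (V₂ x)] [∀ x, TopologicalSpace (V₂ x)]
  [∀ x, IsTopologicalAddGroup (V₂ x)] [∀ x, ContinuousSMul ℝ (V₂ x)]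
  [FiberBundle F₂ V₂] [VectorBundle ℝ F₂ V₂]

/-- Extend `v` by a constant in a local trivialization and multiply by a bump function. -/
theorem exists_section_apply_eq [FiniteDimensional ℝ E] [T2Space M] [IsManifold I ∞ M]
    [ContMDiffVectorBundle ∞ F₁ V₁ I] (x : M) (v : V₁ x) :
    ∃ X : Cₛ^∞⟮I; F₁, V₁⟯, X x = v := by
  obtain ⟨s, hs, hv⟩ := FiberBundle.exists_contMDiffOn_extend (k := ∞) I F₁ v
  obtain ⟨U, hUs, hU, hxU⟩ := mem_nhds_iff.1 hs
  obtain ⟨f, hf, -⟩ := (SmoothBumpFunction.nhds_basis_support (I := I)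
    (hU.mem_nhds hxU)).mem_iff.1 (hU.mem_nhds hxU)
  refine ⟨⟨_, ContMDiffOn.smul_section_of_tsupport (f.contMDiff.contMDiffOn (s := U)) hU hf
    (hv.mono hUs)⟩, ?_⟩
  change f x • FiberBundle.extend F₁ v x = v
  rw [f.eq_one, one_smul, FiberBundle.extend_apply_self]

theorem eq_zero_of_forall_oneForm_apply_eq_zero [FiniteDimensional ℝ E] [T2Space M]
    [IsManifold I ∞ M] [ContMDiffVectorBundle ∞ F₁ V₁ I] (x : M) (v : V₁ x)
    (h : ∀ α : OneForm I F₁ V₁, α x v = 0) : v = 0 := by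
  have e := (trivializationAt F₁ V₁ x).continuousLinearEquivAt ℝ x
    (FiberBundle.mem_baseSet_trivializationAt' x)
  refine e.map_eq_zero_iff.1
    (SeparatingDual.eq_zero_of_forall_dual_eq_zero (R := ℝ) fun φ => ?_)
  obtain ⟨α, hα⟩ := exists_section_apply_eq (I := I) (F₁ := F₁ →L[ℝ] ℝ)
    (V₁ := fun x => Dual V₁ x) x (φ.comp (e : V₁ x →L[ℝ] F₁))
  have h1 := h α
  rw [hα] at h1
  exact h1

/-- A bijective linear map between fibres has a continuous inverse, the fibres being
finite-dimensional and Hausdorff. -/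
theorem isInvertible_of_bijective [FiniteDimensional ℝ F₁] [FiniteDimensional ℝ F₂]
    (x : M) (T : V₁ x →L[ℝ] V₂ x) (hT : Function.Bijective T) : T.IsInvertible := by
  have e₁ := (trivializationAt F₁ V₁ x).continuousLinearEquivAt ℝ x
    (FiberBundle.mem_baseSet_trivializationAt' x)
  have e₂ := (trivializationAt F₂ V₂ x).continuousLinearEquivAt ℝ x
    (FiberBundle.mem_baseSet_trivializationAt' x)
  have : FiniteDimensional ℝ (V₁ x) := e₁.symm.toLinearEquiv.finiteDimensional
  have : T2Space (V₁ x) := e₁.toHomeomorph.symm.t2Space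
  have : T2Space (V₂ x) := e₂.toHomeomorph.symm.t2Space
  exact ⟨(LinearEquiv.ofBijective T.toLinearMap hT).toContinuousLinearEquiv,
    ContinuousLinearMap.ext fun _ => rfl⟩

/-- The inverse of a fibrewise bijective smooth bundle map between bundles of finite rank; in
local trivializations it is the inverse of a smooth family of invertible operators. -/
def invSec [FiniteDimensional ℝ F₁] [FiniteDimensional ℝ F₂]
    (T : Cₛ^∞⟮I; F₁ →L[ℝ] F₂, fun x => V₁ x →L[ℝ] V₂ x⟯)
    (hT : ∀ x, Function.Bijective (T x)) :
    Cₛ^∞⟮I; F₂ →L[ℝ] F₁, fun x => V₂ x →L[ℝ] V₁ x⟯ :=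
  ⟨fun x => (T x).inverse, by
    intro x₀
    have h := (contMDiffAt_hom_bundle _).1 (T.contMDiff x₀)
    refine (contMDiffAt_hom_bundle _).2 ⟨h.1, ?_⟩
    have h₁ := FiberBundle.mem_baseSet_trivializationAt' (F := F₁) (E := V₁) x₀
    have h₂ := FiberBundle.mem_baseSet_trivializationAt' (F := F₂) (E := V₂) x₀
    have hinv : (ContinuousLinearMap.inCoordinates F₁ V₁ F₂ V₂ x₀ x₀ x₀ x₀
        (T x₀)).IsInvertible := by
      rw [ContinuousLinearMap.inCoordinates_eq h₁ h₂]
      obtain ⟨e, he⟩ := isInvertible_of_bijective (F₁ := F₁) (F₂ := F₂) x₀ (T x₀) (hT x₀)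
      rw [← he]
      exact ⟨(((trivializationAt F₁ V₁ x₀).continuousLinearEquivAt ℝ x₀ h₁).symm.trans e).trans
        ((trivializationAt F₂ V₂ x₀).continuousLinearEquivAt ℝ x₀ h₂), rfl⟩
    have : CompleteSpace F₁ := FiniteDimensional.complete ℝ F₁
    have hcomp : ContMDiffAt I 𝓘(ℝ, F₂ →L[ℝ] F₁) ∞ (ContinuousLinearMap.inverse ∘ fun x =>
        ContinuousLinearMap.inCoordinates F₁ V₁ F₂ V₂ x₀ x x₀ x (T x)) x₀ :=
      (hinv.contDiffAt_map_inverse (n := ∞)).comp_contMDiffAt (x := x₀) (f := fun x =>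
        ContinuousLinearMap.inCoordinates F₁ V₁ F₂ V₂ x₀ x x₀ x (T x)) h.2
    refine hcomp.congr_of_eventuallyEq ?_
    filter_upwards [(trivializationAt F₁ V₁ x₀).open_baseSet.mem_nhds h₁,
      (trivializationAt F₂ V₂ x₀).open_baseSet.mem_nhds h₂] with x hx₁ hx₂
    rw [Function.comp_apply, ContinuousLinearMap.inCoordinates_eq hx₂ hx₁,
      ContinuousLinearMap.inCoordinates_eq hx₁ hx₂]
    simp [ContinuousLinearMap.comp_assoc]⟩

end Bundles

/-! ### `PN`- and `PΩ`-structures -/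

section Structures

variable {E : Type*} [NormedAddCommGroup E] [NormedSpace ℝ E]
  {H : Type*} [TopologicalSpace H] {I : ModelWithCorners ℝ E H}
  {M : Type*} [TopologicalSpace M] [ChartedSpace H M]
  {F : Type*} [NormedAddCommGroup F] [NormedSpace ℝ F]
  {V : M → Type*} [TopologicalSpace (TotalSpace F V)]
  [∀ x, AddCommGroup (V x)] [∀ x, Module ℝ (V x)] [∀ x, TopologicalSpace (V x)]
  [∀ x, IsTopologicalAddGroup (V x)] [∀ x, ContinuousSMul ℝ (V x)]
  [FiberBundle F V] [VectorBundle ℝ F V]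

namespace Bivector

variable [FiniteDimensional ℝ F]

/-- The smooth bundle map `(P^♯)⁻¹` of a non-degenerate bivector. -/
def sharpInv (P : Bivector I F V) (hP : P.Nondegenerate) :
    Cₛ^∞⟮I; F →L[ℝ] F →L[ℝ] ℝ, fun x => V x →L[ℝ] Dual V x⟯ :=
  invSec P.sharp hP

theorem isInvertible_sharp (P : Bivector I F V) (hP : P.Nondegenerate) (x : M) :
    (P.sharp x).IsInvertible :=
  isInvertible_of_bijective (F₁ := F →L[ℝ] ℝ) (V₁ := fun x => Dual V x) (F₂ := F) x
    (P.sharp x) (hP x)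

theorem sharp_sharpInv (P : Bivector I F V) (hP : P.Nondegenerate) (x : M) (u : V x) :
    P.sharp x (P.sharpInv hP x u) = u :=
  congrArg (fun T : V x →L[ℝ] V x => T u) (P.isInvertible_sharp hP x).self_comp_inverse

/-- The `2`-form `Ω` with `Ω^♭ = (P^♯)⁻¹ ∘ N`, for a non-degenerate `P` such that
`N ∘ P^♯ = P^♯ ∘ N^*`; the last condition is what makes `Ω` skew-symmetric. -/
def formOfEnd (P : Bivector I F V) (hP : P.Nondegenerate) (N : EndField I F V)
    (hN : ∀ (x : M) (α : Dual V x), N x (P.sharp x α) = P.sharp x (α.comp (N x))) :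
    TwoForm I F V where
  form := ⟨fun x => -compSec (P.sharpInv hP) N x,
    (compSec (P.sharpInv hP) N).contMDiff.neg_section⟩
  skew x u v := by
    obtain ⟨α, rfl⟩ := (hP x).2 u
    obtain ⟨β, rfl⟩ := (hP x).2 v
    have h (α : Dual V x) : P.sharpInv hP x (N x (P.sharp x α)) = α.comp (N x) :=
      (hP x).1 (by rw [sharp_sharpInv, hN])
    change -P.sharpInv hP x (N x (P.sharp x α)) (P.sharp x β)
      = - -P.sharpInv hP x (N x (P.sharp x β)) (P.sharp x α)
    rw [h, h, neg_neg]
    change -α (N x (P.sharp x β)) = β (N x (P.sharp x α))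
    rw [hN x β]
    exact (P.skew x α (β.comp (N x))).symm

theorem flat_formOfEnd (P : Bivector I F V) (hP : P.Nondegenerate) (N : EndField I F V)
    (hN : ∀ (x : M) (α : Dual V x), N x (P.sharp x α) = P.sharp x (α.comp (N x)))
    (x : M) (u : V x) : (P.formOfEnd hP N hN).flat x u = P.sharpInv hP x (N x u) :=
  congrArg (fun T : V x →L[ℝ] Dual V x => T u) (neg_neg ((P.sharpInv hP x).comp (N x)))

theorem compFlat_formOfEnd (P : Bivector I F V) (hP : P.Nondegenerate) (N : EndField I F V)
    (hN : ∀ (x : M) (α : Dual V x), N x (P.sharp x α) = P.sharp x (α.comp (N x))) :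
    P.compFlat (P.formOfEnd hP N hN) = N := by
  refine ContMDiffSection.ext fun x => ContinuousLinearMap.ext fun u => ?_
  change P.sharp x ((P.formOfEnd hP N hN).flat x u) = N x u
  rw [flat_formOfEnd, sharp_sharpInv]

end Bivector

namespace LieAlgebroid

variable [IsManifold I ∞ M] {μ : LieAlgebroid I F V} {P : Bivector I F V} {Ω : TwoForm I F V}

theorem IsPOmega.isPN [FiniteDimensional ℝ E] [T2Space M] [ContMDiffVectorBundle ∞ F V I]
    (h : μ.IsPOmega P Ω) : μ.IsPN P (P.compFlat Ω) where
  poisson := h.poisson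
  nijenhuis X Y := ContMDiffSection.ext fun x =>
    eq_zero_of_forall_oneForm_apply_eq_zero x _ fun γ => by
      rw [μ.torsion_compFlat, h.poisson, h.closed, h.closed, h.closed_twist]
      simp
  compatible :=
    { comm := P.compFlat_sharp Ω
      concomitant_eq_zero := fun α β X x => by
        rw [μ.concomitant_compFlat P Ω, h.closed, h.poisson]
        simp }

/-- For non-degenerate `P`, every section is `P^♯` of a `1`-form, so that the concomitant
determines `d Ω` and the torsion determines `d Ω_N`. -/
theorem IsPN.isPOmega [FiniteDimensional ℝ F] (hP : P.Nondegenerate)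
    (h : μ.IsPN P (P.compFlat Ω)) : μ.IsPOmega P Ω := by
  have hsurj (X : Sec I F V) : applySec P.sharp (applySec (P.sharpInv hP) X) = X :=
    ContMDiffSection.ext fun x => P.sharp_sharpInv hP x (X x)
  have hclosed : μ.IsClosed Ω := fun X Y Z x => by
    have hc := μ.concomitant_compFlat P Ω (applySec (P.sharpInv hP) Y)
      (applySec (P.sharpInv hP) Z) X x
    rw [h.compatible.concomitant_eq_zero, h.poisson, hsurj, hsurj] at hc
    linarith
  refine ⟨h.poisson, hclosed, fun X Y Z x => ?_⟩
  have ht := μ.torsion_compFlat P Ω X Y (applySec (P.sharpInv hP) Z) x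
  rw [h.nijenhuis, h.poisson, hclosed, hclosed, hsurj] at ht
  have h0 : (applySec (P.sharpInv hP) Z) x ((0 : Sec I F V) x) = 0 := map_zero _
  rw [h0] at ht
  linarith

end LieAlgebroid

end Structures

end LieAlgd

end

theorem mainTheorem1
    {E : Type*} [NormedAddCommGroup E] [NormedSpace ℝ E] [FiniteDimensional ℝ E]
    {H : Type*} [TopologicalSpace H] (I : ModelWithCorners ℝ E H)
    {M : Type*} [TopologicalSpace M] [ChartedSpace H M] [IsManifold I ∞ M]
    [BoundarylessManifold I M] [T2Space M] [SigmaCompactSpace M]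
    (F : Type*) [NormedAddCommGroup F] [NormedSpace ℝ F] [FiniteDimensional ℝ F]
    (V : M → Type*) [TopologicalSpace (TotalSpace F V)]
    [∀ x, AddCommGroup (V x)] [∀ x, Module ℝ (V x)] [∀ x, TopologicalSpace (V x)]
    [∀ x, IsTopologicalAddGroup (V x)] [∀ x, ContinuousSMul ℝ (V x)]
    [FiberBundle F V] [VectorBundle ℝ F V] [ContMDiffVectorBundle ∞ F V I]
    (μ : LieAlgd.LieAlgebroid I F V) (P : LieAlgd.Bivector I F V) :
    (∀ Ω : LieAlgd.TwoForm I F V, μ.IsPOmega P Ω → μ.IsPN P (P.compFlat Ω)) ∧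
    (∀ (hP : P.Nondegenerate) (N : LieAlgd.EndField I F V), μ.IsPN P N →
      ∃ Ω : LieAlgd.TwoForm I F V,
        (∀ (x : M) (u : V x), Ω.flat x u = (P.sharpEquiv hP x).symm (N x u)) ∧
        μ.IsPOmega P Ω) := by
  refine ⟨fun Ω hΩ => hΩ.isPN, fun hP N hN => ?_⟩
  have hcomm := hN.compatible.comm
  refine ⟨P.formOfEnd hP N hcomm, fun x u => ?_, ?_⟩
  · refine (LinearEquiv.eq_symm_apply _).2 ?_
    change P.sharp x _ = N x u
    rw [P.flat_formOfEnd, P.sharp_sharpInv]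
  · refine LieAlgd.LieAlgebroid.IsPN.isPOmega hP ?_
    rwa [P.compFlat_formOfEnd]
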